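/- Let $v$ be an indeterminate and $\mathcal A=\mathbb Z[v,v^{-1}]$. For an odd prime power $q$ fix a (split) non-degenerate symmetric bilinear form on $\mathbb F_q^{2d+1}$ and let $X_d$ be the set of $d$-dimensional (that is, maximal) totally isotropic subspaces. For $a,b\in\mathbb N$ with $a+b=d$ let $$[A_{a,b}]=v^{-ab-b(b+1)/2}\,\mathbf 1_{\{(L,L')\in X_d\times X_d\,:\,\dim (L\cap L')=a\}},\qquad v=\sqrt q .$$ Let ${}_{\mathcal A}\mathbf S^\imath(2,d)$ be the $\mathcal A$-span of these elements (taken simultaneously for all odd prime powers $q$, $v$ acting as $\sqrt q$), with convolution as product, and let $\mathbf S^\imath(2,d)=\mathbb Q(v)\otimes_{\mathcal A}{}_{\mathcal A}\mathbf S^\imath(2,d)$ be the rank-one $\imath$Schur algebra; the $[A_{a,b}]$, $a+b=d$, form its standard basis. For $a+r=d$ let $M_{a,r}$ be the convolution product $$M_{a,r}=\bigl(v^{-ar}\,\mathbf 1_{\{(L,U)\,:\,U\subseteq L\}}\bigr)*\bigl(v^{-r(r+1)/2}\,\mathbf 1_{\{(U,L')\,:\,U\subseteq L'\}}\bigr),$$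 where $L,L'\in X_d$ and $U$ runs over the $a$-dimensional totally isotropic subspaces. There is a unique additive map $\overline{\phantom{x}}$ on $\mathbf S^\imath(2,d)$, the bar involution, that is semilinear with respect to the field automorphism $v\mapsto v^{-1}$ of $\mathbb Q(v)$ and fixes $M_{a,r}$ for all $a+r=d$. **Theorem.** For all $a,r\in\mathbb N$ there is a unique bar-invariant element $\{A_{a,r}\}\in\mathbf S^\imath(2,a+r)$ (the canonical basis element) that lies in $[A_{a,r}]+\sum_{i=1}^r v^{-1}\mathbb Z[v^{-1}]\,[A_{a+i,r-i}]$. It has the form $$\{A_{a,r}\}=\sum_{i=0}^r\gamma_a(i)\,[A_{a+i,r-i}],$$ where the coefficients $\gamma_a(i)$ do not depend on $r$ and are given as follows. 1. For $a,s\in\mathbb N$ with $a$ even, $$\gamma_a(2s)=v^{-2s^2-s}\prod_{k=1}^s\frac{1-v^{-2a-4k}}{1-v^{-4k}},\qquad \gamma_a(2s+1)=v^{-a-2s^2-3s-1}\prod_{k=1}^s\frac{1-v^{-2a-4k}}{1-v^{-4k}}.$$ 2. For $a,s\in\mathbb N$ with $a$ odd, $$\gamma_a(2s)=v^{-2s^2+s}\prod_{k=1}^s\frac{1-v^{-2a-4k-2}}{1-v^{-4k}},\qquad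 \gamma_a(2s+1)=v^{-a-2s^2-s-1}\prod_{k=1}^s\frac{1-v^{-2a-4k-2}}{1-v^{-4k}}.$$ -/

import Mathlib

open scoped LaurentPolynomial

noncomputable section

namespace ISchur

/-- The ground ring `𝒜 = ℤ[v, v⁻¹]`; the variable `v` is `LaurentPolynomial.T 1`, and
`v ^ n` is `LaurentPolynomial.T n` for every integer `n`. -/
abbrev A : Type := ℤ[T;T⁻¹]

/-- The power `v ^ n` in `𝒜`. -/
abbrev vpow (n : ℤ) : A := LaurentPolynomial.T n

/-- The field `ℚ(v)`, as the field of fractions of `ℤ[v, v⁻¹]`. -/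
abbrev K : Type := FractionRing A

/-- The element `v` of `ℚ(v)`. -/
def v : K := algebraMap A K (vpow 1)

/-- The bar conjugation of `ℚ(v)`: the field automorphism with `v ↦ v⁻¹`. -/
def barK : K →+* K :=
  (IsFractionRing.ringEquivOfRingEquiv (K := K) (L := K)
    (LaurentPolynomial.invert (R := ℤ)).toRingEquiv : K ≃+* K)

theorem barK_v : barK v = v⁻¹ := by
  have h1 : barK v = algebraMap A K (vpow (-1)) := by
    simp [barK, v, vpow]
  rw [h1]
  refine eq_inv_of_mul_eq_one_left ?_
  rw [v, ← map_mul, ← LaurentPolynomial.T_add]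
  simp

/-- Membership in `v⁻¹ ℤ[v⁻¹]`. -/
def IsNegative (g : K) : Prop :=
  ∃ p : Polynomial ℤ, g = v⁻¹ * Polynomial.aeval v⁻¹ p

/-! ### Finite fields of odd order -/

/-- A power `q = p ^ k` of an odd prime, `k ≥ 1`. -/
structure OddPrimePower where
  p : ℕ
  k : ℕ
  prime : Fact p.Prime
  odd : p ≠ 2
  pos : 0 < k

attribute [instance] OddPrimePower.prime

/-- The finite field with `q` elements. -/
abbrev Fq (q : OddPrimePower) : Type := GaloisField q.p q.k

/-- The order `q` of the finite field. -/
def OddPrimePower.card (q : OddPrimePower) : ℕ := q.p ^ q.k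

theorem sqrt_card_ne_zero (q : OddPrimePower) : Real.sqrt (q.card : ℝ) ≠ 0 := by
  have h : 0 < q.card := pow_pos q.prime.out.pos _
  exact (Real.sqrt_pos.2 (by exact_mod_cast h)).ne'

/-- The specialization `v = √q`. -/
def spec (q : OddPrimePower) : A →+* ℝ :=
  LaurentPolynomial.eval₂ (Int.castRingHom ℝ)
    (Units.mk0 (Real.sqrt (q.card : ℝ)) (sqrt_card_ne_zero q))

/-! ### Isotropic subspaces of the odd orthogonal space -/

/-- The space `𝔽_q ^ (2d+1)`. -/
abbrev V (q : OddPrimePower) (d : ℕ) : Type := Fin (2 * d + 1) → Fq q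

/-- The (split) non-degenerate symmetric bilinear form `∑ x_i y_{2d+2-i}` on `𝔽_q ^ (2d+1)`. -/
def form (q : OddPrimePower) (d : ℕ) (x y : V q d) : Fq q := ∑ i, x i * y (Fin.rev i)

/-- The set of totally isotropic subspaces of dimension `a` of `𝔽_q ^ (2d+1)`. For `a = d` these
are the maximal isotropic subspaces. -/
def Iso (q : OddPrimePower) (d a : ℕ) : Type :=
  {W : Submodule (Fq q) (V q d) //
    Module.finrank (Fq q) W = a ∧ ∀ x ∈ W, ∀ y ∈ W, form q d x y = 0}

instance (q : OddPrimePower) (d a : ℕ) : Finite (Iso q d a) := by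
  unfold Iso
  have : Finite (Submodule (Fq q) (V q d)) :=
    Finite.of_injective (fun W => (W : Set (V q d))) SetLike.coe_injective
  infer_instance

instance (q : OddPrimePower) (d a : ℕ) : Fintype (Iso q d a) := Fintype.ofFinite _

/-! ### Generic convolution algebra -/

/-- Families, indexed by all odd prime powers `q`, of real functions on pairs consisting of an
isotropic subspace of dimension `a` and one of dimension `b`. -/
def Corr (d a b : ℕ) : Type := ∀ q : OddPrimePower, Matrix (Iso q d a) (Iso q d b) ℝ

instance (d a b : ℕ) : AddCommGroup (Corr d a b) :=
  inferInstanceAs (AddCommGroup (∀ q : OddPrimePower, Matrix (Iso q d a) (Iso q d b) ℝ))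

/-- A family is multiplied by an element of `𝒜` by specializing `v = √q` at each `q`. -/
instance (d a b : ℕ) : Module A (Corr d a b) :=
  letI : Module (OddPrimePower → ℝ) (Corr d a b) :=
    inferInstanceAs (Module (∀ _ : OddPrimePower, ℝ)
      (∀ q : OddPrimePower, Matrix (Iso q d a) (Iso q d b) ℝ))
  Module.compHom (Corr d a b) (RingHom.pi spec)

theorem smul_apply {d a b : ℕ} (p : A) (f : Corr d a b) (q : OddPrimePower)
    (W : Iso q d a) (W' : Iso q d b) : (p • f) q W W' = spec q p * f q W W' := rfl

theorem add_apply {d a b : ℕ} (f g : Corr d a b) (q : OddPrimePower)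
    (W : Iso q d a) (W' : Iso q d b) : (f + g) q W W' = f q W W' + g q W W' := rfl

/-- The convolution product `(f * g)(W, W'') = ∑_{W'} f(W, W') g(W', W'')`, for every `q`. -/
def conv {d a b c : ℕ} (f : Corr d a b) (g : Corr d b c) : Corr d a c := fun q => f q * g q

/-- The characteristic function of the pairs `(L, L')` of maximal isotropic subspaces with
`dim (L ∩ L') = a`. -/
def orbit (d a : ℕ) : Corr d d d := fun q => Matrix.of fun L L' =>
  open Classical in if Module.finrank (Fq q) ↥(L.1 ⊓ L'.1) = a then 1 else 0

/-- The standard basis element `[A_{a,b}]` in integral form, for `a + b = d`: the characteristic function of the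
orbit `{(L, L') : dim (L ∩ L') = a}`, times `v ^ (-δ)` where `δ = ab + b(b+1)/2` is the dimension
of the fibre of the orbit over a fixed `L`. -/
def std (d a b : ℕ) : Corr d d d := vpow (-((a * b + (b + 1).choose 2 : ℕ) : ℤ)) • orbit d a

/-- The integral rank-one `ı`Schur algebra: the `𝒜`-span of the standard basis elements
`[A_{a,b}]`, `a + b = d`, with `conv` as product. -/
def SInt (d : ℕ) : Submodule A (Corr d d d) :=
  Submodule.span A {x | ∃ a b : ℕ, a + b = d ∧ x = std d a b}

theorem std_mem {d a b : ℕ} (h : a + b = d) : std d a b ∈ SInt d :=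
  Submodule.subset_span ⟨a, b, h, rfl⟩

open scoped TensorProduct in
/-- The rank-one `ı`Schur algebra `S^ı(2,d)` over `ℚ(v)`. -/
abbrev S (d : ℕ) : Type := K ⊗[A] SInt d

/-- The element of `S^ı(2,d)` given by an element of the integral form. -/
def ofInt {d : ℕ} (x : SInt d) : S d := TensorProduct.mk A K (SInt d) 1 x

/-- The standard basis element `[A_{a,b}]` of `S^ı(2,d)` for `a + b = d` (and `0` otherwise). -/
def basisElt (d a b : ℕ) : S d := if h : a + b = d then ofInt ⟨std d a b, std_mem h⟩ else 0

/-- The characteristic function of the pairs `(L, U)` with `L` maximal isotropic, `dim U = a` and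
`U ⊆ L`. -/
def incidence (d a : ℕ) : Corr d d a := fun _ => Matrix.of fun L U =>
  open Classical in if U.1 ≤ L.1 then 1 else 0

/-- The characteristic function of the pairs `(U, L)` with `L` maximal isotropic, `dim U = a` and
`U ⊆ L`. -/
def coincidence (d a : ℕ) : Corr d a d := fun _ => Matrix.of fun U L =>
  open Classical in if U.1 ≤ L.1 then 1 else 0

/-- The standard basis element of the orbit `{(L, U) : U ⊆ L}`, for `a + r = d`; the fibre over
a fixed `L`, a Grassmannian, has dimension `ar`. -/
def down (d a r : ℕ) : Corr d d a := vpow (-((a * r : ℕ) : ℤ)) • incidence d a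

/-- The standard basis element of the orbit `{(U, L) : U ⊆ L}`, for `a + r = d`; the fibre over
a fixed `U`, a maximal isotropic Grassmannian of a `2r+1`-dimensional space, has dimension
`r(r+1)/2`. -/
def up (d a r : ℕ) : Corr d a d := vpow (-(((r + 1).choose 2 : ℕ) : ℤ)) • coincidence d a

/-- The monomial basis element `M_{a,r}`, for `a + r = d`: the product of two divided powers of
Chevalley generators. -/
def mono (d a r : ℕ) : Corr d d d := conv (down d a r) (up d a r)

/-! ### Bar involution and canonical basis -/

/-- The bar involution of `S^ı(2,d)`: the additive map with `bar (p x) = (barK p) (bar x)` for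
`p ∈ ℚ(v)` which fixes the monomial basis elements `M_{a,r}` (these lie in the integral form). -/
def IsBar (d : ℕ) (bar : S d →ₛₗ[barK] S d) : Prop :=
  ∀ a r : ℕ, a + r = d → ∃ m : SInt d, (m : Corr d d d) = mono d a r ∧ bar (ofInt m) = ofInt m

/-- `x` is the canonical basis element `{A_{a,r}}`, for `a + r = d`: it is bar invariant and lies in
`[A_{a,r}] + ∑_{i=1}^r v⁻¹ℤ[v⁻¹] [A_{a+i,r-i}]`. -/
def IsCanonical (d : ℕ) (bar : S d →ₛₗ[barK] S d) (a r : ℕ) (x : S d) : Prop :=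
  bar x = x ∧ ∃ g : ℕ → K, (∀ i ∈ Finset.Icc 1 r, IsNegative (g i)) ∧
    x = basisElt d a r + ∑ i ∈ Finset.Icc 1 r, g i • basisElt d (a + i) (r - i)

end ISchur

end

noncomputable section

namespace ISchur

/-! ### Gaussian binomial coefficients -/

/-! The value of `M_{j,d-j}` at `(L, L')` counts the `j`-dimensional subspaces of `L ∩ L'`. Hence
its coefficient at `[A_{n,d-n}]` is `transCoef v n j`, a power of `v` times a Gaussian binomial at
`v ^ 2` (`mono_eq_sum`). This matrix is unitriangular and does not involve `d`; so the monomials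
form a basis, the bar involution exists and is unique, and bar invariance means that all monomial
coefficients are fixed by `barK` (`bar_eq_self_iff`). Uniqueness of the canonical element is the
usual triangularity argument, since only `0` is bar invariant in `v⁻¹ ℤ[v⁻¹]`.

Existence is explicit. The monomial coefficients `auxCoef x b j` are products of quotients of
brackets `x ^ n - x ^ (-n)`, hence bar invariant, and satisfy a first-order recurrence in `j`.
Creative telescoping turns this into a three-term recurrence in `n` for the standard coefficients
(`auxStdCoef_rec`), which a product formula solves (`auxStdCoef_closed`). If `b` is even, the
product is a Gaussian binomial at `x⁻¹ ^ 4` (`closedProd_eq_gaussBinom`), which gives the required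
negativity, so `b = a` settles even `a`.

For odd `a` one uses `b = a + 1`: two neighbouring coefficients `auxCoef x (a + 1) (j + 1)` and
`auxCoef x (a + 1) j` are combined so that the recurrence in `j` gives bar invariance
(`map_canCoef`), while the Pascal rule shows that the standard coefficients are `x ^ i * auxStdCoef
x (a + 1) (a + 1 + i)` (`sum_canCoef_mul_transCoef`). -/

/-- The Gaussian binomial coefficient, evaluated at an element `q` of a ring. -/
def gaussBinom {R : Type*} [CommRing R] (q : R) : ℕ → ℕ → R
  | _, 0 => 1
  | 0, _ + 1 => 0
  | n + 1, k + 1 => gaussBinom q n k + q ^ (k + 1) * gaussBinom q n (k + 1)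

section GaussBinom

variable {R : Type*} [CommRing R] (q : R)

@[simp] theorem gaussBinom_zero_right (n : ℕ) : gaussBinom q n 0 = 1 := by
  cases n <;> rfl

@[simp] theorem gaussBinom_zero_succ (k : ℕ) : gaussBinom q 0 (k + 1) = 0 := rfl

theorem gaussBinom_succ_succ (n k : ℕ) :
    gaussBinom q (n + 1) (k + 1) = gaussBinom q n k + q ^ (k + 1) * gaussBinom q n (k + 1) := rfl

theorem gaussBinom_eq_zero_of_lt {n k : ℕ} (h : n < k) : gaussBinom q n k = 0 := by
  induction n generalizing k with
  | zero => obtain ⟨k, rfl⟩ := Nat.exists_eq_succ_of_ne_zero h.ne'; rfl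
  | succ n ih =>
    obtain ⟨k, rfl⟩ := Nat.exists_eq_succ_of_ne_zero (Nat.zero_lt_of_lt h).ne'
    rw [Nat.succ_eq_add_one, gaussBinom_succ_succ, ih (by omega), ih (by omega)]
    ring

@[simp] theorem gaussBinom_self (n : ℕ) : gaussBinom q n n = 1 := by
  induction n with
  | zero => rfl
  | succ n ih =>
    rw [gaussBinom_succ_succ, ih, gaussBinom_eq_zero_of_lt q (Nat.lt_succ_self n)]
    ring

theorem map_gaussBinom {R' F : Type*} [CommRing R'] [FunLike F R R'] [RingHomClass F R R']
    (f : F) (n k : ℕ) : f (gaussBinom q n k) = gaussBinom (f q) n k := by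
  induction n generalizing k with
  | zero => cases k <;> simp
  | succ n ih => cases k <;> simp [gaussBinom_succ_succ, ih]

/-- The ratio of neighbours in a row, multiplied by `q ^ k` so that no truncated exponent `n - k`
occurs. -/
theorem gaussBinom_succ_right (n k : ℕ) :
    (q ^ (k + 1) - 1) * q ^ k * gaussBinom q n (k + 1) = (q ^ n - q ^ k) * gaussBinom q n k := by
  induction n generalizing k with
  | zero =>
    cases k <;> simp
  | succ n ih =>
    cases k with
    | zero =>
      have := ih 0
      simp only [gaussBinom_succ_succ, gaussBinom_zero_right] at this ⊢
      linear_combination q * this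
    | succ k =>
      have h1 := ih k
      have h2 := ih (k + 1)
      simp only [gaussBinom_succ_succ] at h1 h2 ⊢
      linear_combination q ^ (k + 2) * h2 + q * h1

/-- For `q` the order of a finite field and `k ≤ n`, the two products count the ordered bases of a
`k`-space and the independent `k`-tuples in an `n`-space. -/
theorem gaussBinom_mul_prod (n k : ℕ) :
    gaussBinom q n k * ∏ i ∈ Finset.range k, (q ^ k - q ^ i) =
      ∏ i ∈ Finset.range k, (q ^ n - q ^ i) := by
  induction k with
  | zero => simp
  | succ k ih =>
    have h : ∏ i ∈ Finset.range (k + 1), (q ^ (k + 1) - q ^ i) =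
        (q ^ (k + 1) - 1) * q ^ k * ∏ i ∈ Finset.range k, (q ^ k - q ^ i) := by
      rw [Finset.prod_range_succ']
      simp_rw [pow_succ' q, ← mul_sub]
      rw [Finset.prod_mul_distrib]
      simp
      ring
    rw [h, Finset.prod_range_succ, ← ih]
    linear_combination (∏ i ∈ Finset.range k, (q ^ k - q ^ i)) * gaussBinom_succ_right q n k

/-- The absorption identity. -/
theorem gaussBinom_absorb (n k : ℕ) :
    (q ^ (k + 1) - 1) * gaussBinom q (n + 1) (k + 1) = (q ^ (n + 1) - 1) * gaussBinom q n k := by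
  induction n generalizing k with
  | zero => cases k <;> simp [gaussBinom_succ_succ]
  | succ n ih =>
    have h1 := gaussBinom_succ_right q (n + 1) k
    cases k with
    | zero =>
      have h0 := ih 0
      simp only [gaussBinom_succ_succ q (n + 1), gaussBinom_zero_right] at h0 ⊢
      linear_combination q * h0
    | succ k =>
      have h2 := ih k
      have h3 := ih (k + 1)
      have h4 := gaussBinom_succ_succ q n k
      rw [gaussBinom_succ_succ q (n + 1) (k + 1)]
      linear_combination q ^ (k + 2) * h3 + q * h2 - (q ^ (n + 2) - q) * h4

end GaussBinom

/-! ### Counting subspaces -/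

section Count

variable {F V : Type*} [Field F] [Fintype F] [AddCommGroup V] [Module F V] [Finite V]

/-- A linearly independent family of length `k` is a basis of a subspace of dimension `k`. -/
def linearIndependentEquivSigma (F V : Type*) [Field F] [AddCommGroup V] [Module F V]
    [Module.Finite F V] (k : ℕ) :
    { s : Fin k → V // LinearIndependent F s } ≃
      Σ W : { W : Submodule F V // Module.finrank F W = k },
        { t : Fin k → W.1 // LinearIndependent F t } where
  toFun s := ⟨⟨Submodule.span F (Set.range s.1), by simpa using finrank_span_eq_card s.2⟩,
    ⟨fun i => ⟨s.1 i, Submodule.subset_span ⟨i, rfl⟩⟩,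
      LinearIndependent.of_comp (Submodule.subtype _) s.2⟩⟩
  invFun x := ⟨fun i => x.2.1 i, x.2.2.map' (Submodule.subtype _) (Submodule.ker_subtype _)⟩
  left_inv s := rfl
  right_inv := by
    rintro ⟨⟨W, hW⟩, ⟨t, ht⟩⟩
    have hspan : Submodule.span F (Set.range fun i => (t i : V)) = W := by
      apply Submodule.eq_of_le_of_finrank_eq
      · rw [Submodule.span_le]; rintro _ ⟨i, rfl⟩; exact (t i).2
      · rw [hW, finrank_span_eq_card (b := fun i => (t i : V))
          (ht.map' (Submodule.subtype _) (Submodule.ker_subtype _)), Fintype.card_fin]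
    -- The type of the tuple depends on the subspace; with `W'` general, the equality of subspaces
    -- can be substituted.
    have key : ∀ (W' : { W : Submodule F V // Module.finrank F W = k })
        (t' : { t : Fin k → W'.1 // LinearIndependent F t }), W'.1 = W →
        (∀ i, (t'.1 i : V) = t i) →
        (⟨W', t'⟩ : Σ W : { W : Submodule F V // Module.finrank F W = k },
          { t : Fin k → W.1 // LinearIndependent F t }) = ⟨⟨W, hW⟩, ⟨t, ht⟩⟩ := by
      rintro ⟨W', _⟩ ⟨t', _⟩ rfl h
      obtain rfl : t' = t := funext fun i => Subtype.ext (h i)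
      rfl
    exact key _ _ hspan fun _ => rfl

/-- Independent `k`-tuples are counted twice: directly, and grouped by their span. -/
theorem card_submodule_mul_prod {k : ℕ} (hk : k ≤ Module.finrank F V) :
    Nat.card { W : Submodule F V // Module.finrank F W = k } *
        ∏ i ∈ Finset.range k, ((Fintype.card F : ℝ) ^ k - (Fintype.card F : ℝ) ^ i) =
      ∏ i ∈ Finset.range k,
        ((Fintype.card F : ℝ) ^ Module.finrank F V - (Fintype.card F : ℝ) ^ i) := by
  have hcast : ∀ m, k ≤ m → ((∏ i : Fin k, (Fintype.card F ^ m - Fintype.card F ^ i.val) : ℕ) : ℝ)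
      = ∏ i ∈ Finset.range k, ((Fintype.card F : ℝ) ^ m - (Fintype.card F : ℝ) ^ i) := by
    intro m hm
    rw [← Fin.prod_univ_eq_prod_range (fun i => (Fintype.card F : ℝ) ^ m - (Fintype.card F : ℝ) ^ i),
      Nat.cast_prod]
    refine Finset.prod_congr rfl fun i _ => ?_
    rw [Nat.cast_sub (Nat.pow_le_pow_right Fintype.card_pos (by omega))]
    push_cast
    rfl
  have : Finite (Submodule F V) :=
    Finite.of_injective (fun W => (W : Set V)) SetLike.coe_injective
  have : Fintype { W : Submodule F V // Module.finrank F W = k } := Fintype.ofFinite _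
  have h := Nat.card_congr (linearIndependentEquivSigma F V k)
  rw [card_linearIndependent hk, Nat.card_sigma, Finset.sum_congr rfl fun W _ =>
    card_linearIndependent (K := F) (V := W.1) (k := k) W.2.ge] at h
  have hW (W : { W : Submodule F V // Module.finrank F W = k }) : Module.finrank F W.1 = k := W.2
  simp only [hW] at h
  rw [Finset.sum_const, smul_eq_mul, Finset.card_univ] at h
  simp only [Nat.card_eq_fintype_card] at h ⊢
  rw [← hcast _ hk, ← hcast _ le_rfl, h]
  push_cast
  rfl

/-- The number of subspaces of dimension `k` is a Gaussian binomial coefficient. -/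
theorem card_submodule (k : ℕ) :
    (Nat.card { W : Submodule F V // Module.finrank F W = k } : ℝ) =
      gaussBinom (Fintype.card F : ℝ) (Module.finrank F V) k := by
  rcases lt_or_ge (Module.finrank F V) k with hk | hk
  · rw [gaussBinom_eq_zero_of_lt _ hk]
    have : IsEmpty { W : Submodule F V // Module.finrank F W = k } :=
      ⟨fun W => absurd (Submodule.finrank_le W.1) (by rw [W.2]; omega)⟩
    simp
  · have hq : (1 : ℝ) < Fintype.card F := by exact_mod_cast Fintype.one_lt_card
    refine mul_right_cancel₀ (b := ∏ i ∈ Finset.range k,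
      ((Fintype.card F : ℝ) ^ k - (Fintype.card F : ℝ) ^ i)) ?_ ?_
    · refine Finset.prod_ne_zero_iff.2 fun i hi => ?_
      exact (sub_pos.2 (pow_lt_pow_right₀ hq (Finset.mem_range.1 hi))).ne'
    · rw [card_submodule_mul_prod hk, gaussBinom_mul_prod]

theorem card_submodule_le (E : Submodule F V) (k : ℕ) :
    (Nat.card { W : Submodule F V // Module.finrank F W = k ∧ W ≤ E } : ℝ) =
      gaussBinom (Fintype.card F : ℝ) (Module.finrank F E) k := by
  rw [← card_submodule (V := E)]
  congr 1
  refine Nat.card_congr ?_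
  exact
    { toFun := fun W => ⟨W.1.comap E.subtype, by
        exact (Submodule.comapSubtypeEquivOfLe W.2.2).finrank_eq.trans W.2.1⟩
      invFun := fun W => ⟨W.1.map E.subtype,
        (Submodule.finrank_map_subtype_eq E W.1).trans W.2, Submodule.map_subtype_le E W.1⟩
      left_inv := fun W => Subtype.ext (by
        simpa [Submodule.map_comap_subtype] using W.2.2)
      right_inv := fun W => Subtype.ext 
        (Submodule.comap_map_eq_of_injective E.injective_subtype W.1) }

end Count

/-! ### The transition coefficients between the monomial and the standard basis -/

section Coefficients

variable {k : Type*} [Field k] (x : k)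

/-- The unnormalized quantum integer `x ^ n - x ^ (-n)`. -/
def br (n : ℤ) : k := x ^ n - x ^ (-n)

/-- The coefficient of the monomial basis element with index `j` in an auxiliary bar invariant
element with leading index `b`. -/
def auxCoef (b j : ℕ) : k :=
  if j < b then 0 else ∏ i ∈ Finset.range (j - b), -br x (b + 2 * i) / br x (i + 1)

/-- The coefficient of the standard basis element with index `n` in the monomial basis element with
index `j`. -/
def transCoef (n j : ℕ) : k :=
  x ^ (((j + 1).choose 2 : ℤ) - ((n + 1).choose 2 : ℤ)) * gaussBinom (x ^ 2) n j

/-- The coefficient of the standard basis element with index `n` in the auxiliary bar invariant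
element with leading index `b`. -/
def auxStdCoef (b n : ℕ) : k := ∑ j ∈ Finset.range (n + 1), auxCoef x b j * transCoef x n j

theorem choose_succ_two (n : ℕ) :
    ((n + 1 + 1).choose 2 : ℤ) = (n + 1).choose 2 + (n + 1) := by
  rw [Nat.choose_succ_succ' (n + 1) 1]
  push_cast [Nat.choose_one_right]
  ring

variable {x}

@[simp] theorem br_zero : br x 0 = 0 := by simp [br]

theorem br_ne_zero (hx : ∀ n : ℤ, n ≠ 0 → x ^ n ≠ 1) {n : ℤ} (hn : n ≠ 0) (h0 : x ≠ 0) :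
    br x n ≠ 0 := by
  intro h
  refine hx (n + n) (by omega) ?_
  rw [zpow_add₀ h0]
  nth_rw 1 [sub_eq_zero.1 h]
  rw [zpow_neg, inv_mul_cancel₀ (zpow_ne_zero _ h0)]

theorem auxCoef_of_lt {b j : ℕ} (h : j < b) : auxCoef x b j = 0 := if_pos h

@[simp] theorem auxCoef_self (b : ℕ) : auxCoef x b b = 1 := by simp [auxCoef]

/-- For `j = b + i` this is the last factor of the product, as `b + 2 * i = 2 * j - b`. It persists
at `j + 1 = b` because `br x 0 = 0`, so sums over `j` may start at `0`. -/
theorem auxCoef_succ (hx : ∀ n : ℤ, n ≠ 0 → x ^ n ≠ 1) (h0 : x ≠ 0) (b j : ℕ) :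
    br x (j + 1 - b) * auxCoef x b (j + 1) = -br x (2 * j - b) * auxCoef x b j := by
  rcases lt_trichotomy (j + 1) b with h | rfl | h
  · rw [auxCoef_of_lt h, auxCoef_of_lt (by omega)]; simp
  · rw [auxCoef_of_lt (Nat.lt_succ_self j)]; simp
  · obtain ⟨i, rfl⟩ := Nat.exists_eq_add_of_le (Nat.lt_succ_iff.1 h)
    have hi : br x ((i : ℤ) + 1) ≠ 0 := br_ne_zero hx (by omega) h0
    rw [auxCoef, auxCoef, if_neg (by omega), if_neg (by omega),
      show b + i + 1 - b = i + 1 by omega, Nat.add_sub_cancel_left, Finset.prod_range_succ,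
      show ((b + i : ℕ) : ℤ) + 1 - b = i + 1 by push_cast; ring,
      show 2 * ((b + i : ℕ) : ℤ) - b = b + 2 * i by push_cast; ring]
    field_simp

theorem transCoef_of_lt {n j : ℕ} (h : n < j) : transCoef x n j = 0 := by
  rw [transCoef, gaussBinom_eq_zero_of_lt _ h, mul_zero]

@[simp] theorem transCoef_self (n : ℕ) : transCoef x n n = 1 := by
  simp [transCoef]

theorem transCoef_succ_zero (h0 : x ≠ 0) (n : ℕ) :
    transCoef x (n + 1) 0 = x ^ (-(n : ℤ) - 1) * transCoef x n 0 := by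
  simp only [transCoef, gaussBinom_zero_right, mul_one, choose_succ_two]
  rw [← zpow_add₀ h0]
  congr 1
  ring

theorem transCoef_succ_succ (h0 : x ≠ 0) (n j : ℕ) :
    transCoef x (n + 1) (j + 1) =
      x ^ (2 * (j : ℤ) + 1 - n) * transCoef x n (j + 1) + x ^ ((j : ℤ) - n) * transCoef x n j := by
  simp only [transCoef, gaussBinom_succ_succ, choose_succ_two]
  rw [← mul_assoc, ← mul_assoc, ← zpow_add₀ h0, ← zpow_add₀ h0, ← pow_mul,
    ← zpow_natCast x (2 * (j + 1)), mul_add, ← mul_assoc, ← zpow_add₀ h0, add_comm]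
  congr 3 <;> push_cast <;> ring

theorem sum_transCoef_eq_auxStdCoef (b : ℕ) {n N : ℕ} (h : n < N) :
    ∑ j ∈ Finset.range N, auxCoef x b j * transCoef x n j = auxStdCoef x b n := by
  refine (Finset.sum_subset (Finset.range_subset_range.2 h) fun j _ hj => ?_).symm
  rw [transCoef_of_lt (by simpa using hj), mul_zero]

/-- The boundary term `j = 0` of the telescoping sum in `auxStdCoef_rec`. -/
theorem transCoef_rec_zero (h0 : x ≠ 0) (n b : ℕ) :
    br x (n + 2 - b) * transCoef x (n + 2) 0
      - br x 1 * x ^ ((b : ℤ) - 2 * n - 3) * transCoef x (n + 1) 0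
      - x ^ ((b : ℤ) - 2 * n - 2) * br x (n + 1) * transCoef x n 0 =
    br x (-b) * transCoef x (n + 1) 0 := by
  rw [transCoef_succ_zero h0 (n + 1), transCoef_succ_zero h0 n]
  simp only [br, Nat.cast_add, Nat.cast_one]
  have hn := zpow_ne_zero n h0
  have hb := zpow_ne_zero b h0
  simp only [zpow_sub₀ h0, zpow_add₀ h0, zpow_neg, zpow_mul', zpow_ofNat, zpow_natCast,
    neg_sub, neg_add, mul_comm (2 : ℤ)]
  field_simp
  ring

/-- The recurrence operator in `n` applied to `transCoef`, written so that after multiplication by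
`auxCoef x b (j + 1)` the relation `auxCoef_succ` turns the right side into a difference in `j`. -/
theorem transCoef_rec_succ (h0 : x ≠ 0) (n j b : ℕ) :
    br x (n + 2 - b) * transCoef x (n + 2) (j + 1)
      - br x 1 * x ^ ((b : ℤ) - 2 * n - 3) * transCoef x (n + 1) (j + 1)
      - x ^ ((b : ℤ) - 2 * n - 2) * br x (n + 1) * transCoef x n (j + 1) =
    br x (j + 1 - b) * transCoef x (n + 1) j +
      br x (2 * j + 2 - b) * transCoef x (n + 1) (j + 1) := by
  have hn := pow_ne_zero n h0
  have hj := pow_ne_zero j h0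
  have hb := pow_ne_zero b h0
  have h1 := gaussBinom_succ_right (x ^ 2) (n + 1) j
  have h2 := gaussBinom_succ_right (x ^ 2) (n + 1) (j + 1)
  have h3 := gaussBinom_absorb (x ^ 2) n (j + 1)
  simp only [transCoef, choose_succ_two, gaussBinom_succ_succ (x ^ 2) (n + 1) j]
  generalize gaussBinom (x ^ 2) (n + 1) (j + 1 + 1) = g2 at *
  generalize gaussBinom (x ^ 2) (n + 1) (j + 1) = g1 at *
  generalize gaussBinom (x ^ 2) (n + 1) j = g0 at *
  generalize gaussBinom (x ^ 2) n (j + 1) = g at *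
  have hJ := pow_ne_zero ((j + 1).choose 2) h0
  have hN := pow_ne_zero ((n + 1).choose 2) h0
  simp only [br, zpow_sub₀ h0, zpow_add₀ h0, zpow_neg, zpow_mul', zpow_ofNat,
    zpow_natCast, neg_sub, neg_add, mul_comm (2 : ℤ), Nat.cast_add, Nat.cast_one, ← pow_mul,
    pow_add, pow_one, mul_comm 2] at h1 h2 h3 ⊢
  generalize x ^ (j + 1).choose 2 = J at *
  generalize x ^ (n + 1).choose 2 = N at *
  simp only [pow_mul] at h1 h2 h3 ⊢
  generalize x ^ n = X at *
  generalize x ^ j = Y at *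
  generalize x ^ b = B at *
  -- Eliminating `g2` between `h2` and `h3` relates `g` and `g1`; the goal then follows from `e1`
  -- and `h1`, and `key` is the goal stripped of a common monomial.
  have e1 : Y ^ 2 * x ^ 2 * (X ^ 2 * x ^ 2 - 1) * g = (X ^ 2 * x ^ 2 - Y ^ 2 * x ^ 2) * g1 := by
    linear_combination h2 - Y ^ 2 * x ^ 2 * h3
  have key : (B⁻¹ - B * X⁻¹ ^ 2 * x⁻¹ ^ 4) * (g0 + Y ^ 2 * x ^ 2 * g1)
      - B * (X⁻¹ ^ 2 * x⁻¹ ^ 2 - X⁻¹ ^ 2 * x⁻¹ ^ 4) * g1 - B * (1 - X⁻¹ ^ 2 * x⁻¹ ^ 2) * g =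
      (B⁻¹ - B * Y⁻¹ ^ 2 * x⁻¹ ^ 2) * g0 + (B⁻¹ * Y ^ 2 * x ^ 2 - B * Y⁻¹ ^ 2 * x⁻¹ ^ 2) * g1 := by
    linear_combination (norm := (field_simp; ring))
      (-B * X⁻¹ ^ 2 * x⁻¹ ^ 4 * Y⁻¹ ^ 2) * (e1 + h1)
  linear_combination (norm := (field_simp; ring)) (J * Y * N⁻¹ * X⁻¹) * key

/-- The recurrence in `n` for the coefficients of an auxiliary bar invariant element. -/
theorem auxStdCoef_rec (hx : ∀ n : ℤ, n ≠ 0 → x ^ n ≠ 1) (h0 : x ≠ 0) (b n : ℕ) :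
    br x (n + 2 - b) * auxStdCoef x b (n + 2) =
      br x 1 * x ^ ((b : ℤ) - 2 * n - 3) * auxStdCoef x b (n + 1) +
        x ^ ((b : ℤ) - 2 * n - 2) * br x (n + 1) * auxStdCoef x b n := by
  rw [← sub_eq_zero, ← sub_sub]
  rw [← sum_transCoef_eq_auxStdCoef b (show n + 2 < n + 2 + 1 by omega),
    ← sum_transCoef_eq_auxStdCoef b (show n + 1 < n + 2 + 1 by omega),
    ← sum_transCoef_eq_auxStdCoef b (show n < n + 2 + 1 by omega),
    Finset.mul_sum, Finset.mul_sum, Finset.mul_sum, ← Finset.sum_sub_distrib,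
    ← Finset.sum_sub_distrib]
  -- The telescoping certificate: the summand at `j + 1` is `W (j + 1) - W j`, the summand at `0` is
  -- `W 0`, and `W (n + 2) = 0`.
  set W : ℕ → k := fun j => auxCoef x b j * br x (2 * j - b) * transCoef x (n + 1) j with hW
  rw [Finset.sum_range_succ', Finset.sum_congr rfl (g := fun j => W (j + 1) - W j),
    Finset.sum_range_sub]
  · have h1 : W (n + 2) = 0 := by simp only [hW]; rw [transCoef_of_lt (by omega), mul_zero]
    have h2 := transCoef_rec_zero h0 n b
    rw [h1]
    simp only [hW, Nat.cast_zero, mul_zero, zero_sub]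
    linear_combination auxCoef x b 0 * h2
  · intro j _
    have h1 := transCoef_rec_succ h0 n j b
    have h2 := auxCoef_succ hx h0 b j
    simp only [hW, Nat.cast_add, Nat.cast_one]
    rw [show 2 * ((j : ℤ) + 1) - b = 2 * j + 2 - b by ring]
    linear_combination auxCoef x b (j + 1) * h1 + transCoef x (n + 1) j * h2

theorem auxStdCoef_of_lt {b n : ℕ} (h : n < b) : auxStdCoef x b n = 0 :=
  Finset.sum_eq_zero fun j hj => by
    rw [auxCoef_of_lt (by rw [Finset.mem_range] at hj; omega), zero_mul]

@[simp] theorem auxStdCoef_self (b : ℕ) : auxStdCoef x b b = 1 := by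
  rw [auxStdCoef, Finset.sum_range_succ, Finset.sum_eq_zero]
  · simp
  · intro j hj
    rw [auxCoef_of_lt (by simpa using hj), zero_mul]

end Coefficients

/-! ### Closed formulas -/

section ClosedFormulas

variable {k : Type*} [Field k] {x : k}

/-- The second initial value: for `b > 0` it is the recurrence at `n = b - 1`, where `auxStdCoef x b
(b - 1) = 0`. For `b = 0` only the term `j = 0` survives, since `br x 0 = 0`. -/
theorem auxStdCoef_succ_self (hx : ∀ n : ℤ, n ≠ 0 → x ^ n ≠ 1) (h0 : x ≠ 0) (b : ℕ) :
    auxStdCoef x b (b + 1) = x ^ (-(b : ℤ) - 1) := by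
  have h1 : br x 1 ≠ 0 := br_ne_zero hx one_ne_zero h0
  cases b with
  | zero =>
    simp [auxStdCoef, Finset.sum_range_succ, auxCoef, transCoef]
  | succ b =>
    have h := auxStdCoef_rec hx h0 (b + 1) b
    rw [auxStdCoef_self, auxStdCoef_of_lt (Nat.lt_succ_self b)] at h
    refine mul_left_cancel₀ h1 ?_
    push_cast at h ⊢
    rw [show (b : ℤ) + 2 - (b + 1) = 1 by ring] at h
    rw [show b + 1 + 1 = b + 2 from rfl, h]
    simp only [mul_one, mul_zero, add_zero]
    congr 2
    ring

/-- The product occurring in the closed formulas. -/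
def closedProd (x : k) (b s : ℕ) : k :=
  ∏ i ∈ Finset.Icc 1 s, (1 - x ^ (-2 * (b : ℤ) - 4 * (i : ℤ))) / (1 - x ^ (-4 * (i : ℤ)))

theorem closedProd_succ (b s : ℕ) : closedProd x b (s + 1) = closedProd x b s *
    ((1 - x ^ (-2 * (b : ℤ) - 4 * (s + 1 : ℤ))) / (1 - x ^ (-4 * (s + 1 : ℤ)))) := by
  rw [closedProd, Finset.prod_Icc_succ_top (by omega)]
  push_cast
  rfl

/-- The recurrence has order two, so both parities are carried through one induction: `r1` yields
the next even value and `r2` the next odd one. -/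
theorem auxStdCoef_closed (hx : ∀ n : ℤ, n ≠ 0 → x ^ n ≠ 1) (h0 : x ≠ 0) (b s : ℕ) :
    auxStdCoef x b (b + 2 * s) = x ^ (-2 * (s : ℤ) ^ 2 - s) * closedProd x b s ∧
    auxStdCoef x b (b + (2 * s + 1)) =
      x ^ (-(b : ℤ) - 2 * (s : ℤ) ^ 2 - 3 * s - 1) * closedProd x b s := by
  induction s with
  | zero => simp [closedProd, auxStdCoef_succ_self hx h0]
  | succ s ih =>
    obtain ⟨ih1, ih2⟩ := ih
    have hb2 : br x (2 * s + 2) ≠ 0 := br_ne_zero hx (by omega) h0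
    have hb3 : br x (2 * s + 3) ≠ 0 := br_ne_zero hx (by omega) h0
    have hd : 1 - x ^ (-4 * (s + 1 : ℤ)) ≠ 0 :=
      sub_ne_zero.2 (hx _ (by omega)).symm
    have hs := pow_ne_zero s h0
    have hb := pow_ne_zero b h0
    have hs2 := pow_ne_zero (s ^ 2) h0
    -- The denominator `hd` in positive powers, the shape it takes once `field_simp` clears
    -- inverses.
    have hd' : x ^ 4 * (x ^ s) ^ 4 - 1 ≠ 0 := by
      rw [← mul_pow, ← pow_succ', ← pow_mul, ← zpow_natCast]
      exact sub_ne_zero.2 (hx _ (by push_cast; omega))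
    have r1 := auxStdCoef_rec hx h0 b (b + 2 * s)
    have r2 := auxStdCoef_rec hx h0 b (b + (2 * s + 1))
    rw [show b + 2 * s + 2 = b + 2 * (s + 1) by ring, ih1,
      show b + 2 * s + 1 = b + (2 * s + 1) by ring, ih2,
      show ((b + 2 * s : ℕ) : ℤ) + 2 - b = 2 * s + 2 by push_cast; ring] at r1
    rw [show b + (2 * s + 1) + 2 = b + (2 * (s + 1) + 1) by ring,
      show b + (2 * s + 1) + 1 = b + 2 * (s + 1) by ring, ih2,
      show ((b + (2 * s + 1) : ℕ) : ℤ) + 2 - b = 2 * s + 3 by push_cast; ring] at r2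
    have e1 : auxStdCoef x b (b + 2 * (s + 1)) =
        x ^ (-2 * ((s + 1 : ℕ) : ℤ) ^ 2 - ((s + 1 : ℕ) : ℤ)) * closedProd x b (s + 1) := by
      refine mul_left_cancel₀ hb2 (r1.trans ?_)
      simp only [br, closedProd_succ, Nat.cast_add, Nat.cast_mul, Nat.cast_one, Nat.cast_ofNat,
        add_sq, mul_add, mul_one, one_pow, neg_mul, zpow_sub₀ h0, zpow_add₀ h0, zpow_neg,
        zpow_mul', zpow_ofNat, zpow_natCast, neg_add, ← Nat.cast_pow]
      generalize closedProd x b s = P at *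
      generalize x ^ (s ^ 2) = S at *
      generalize x ^ s = Z at *
      generalize x ^ b = B at *
      field_simp
      ring
    refine ⟨e1, mul_left_cancel₀ hb3 (r2.trans ?_)⟩
    rw [e1]
    simp only [br, closedProd_succ, Nat.cast_add, Nat.cast_mul, Nat.cast_one, Nat.cast_ofNat,
      add_sq, mul_add, mul_one, one_pow, neg_mul, zpow_sub₀ h0, zpow_add₀ h0, zpow_neg,
      zpow_mul', zpow_ofNat, zpow_natCast, neg_add, ← Nat.cast_pow]
    generalize closedProd x b s = P at *
    generalize x ^ (s ^ 2) = S at *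
    generalize x ^ s = Z at *
    generalize x ^ b = B at *
    field_simp
    ring

end ClosedFormulas

/-! ### Coefficients of the canonical basis -/

section Canonical

variable {k : Type*} [Field k] {x : k}

/-- The coefficient of the monomial basis element with index `j` in the canonical basis element
with leading index `a`. -/
def canCoef (x : k) (a j : ℕ) : k :=
  if Even a then auxCoef x a j
  else x ^ ((j : ℤ) - a) * auxCoef x (a + 1) (j + 1) +
    x ^ (2 * (j : ℤ) - (a + 1)) * auxCoef x (a + 1) j

/-- The coefficient of the standard basis element with index `a + i` in the canonical basis
element with leading index `a`. -/
def canStdCoef (x : k) (a i : ℕ) : k :=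
  if Even a then auxStdCoef x a (a + i) else x ^ i * auxStdCoef x (a + 1) (a + 1 + i)

theorem map_br {σ : k →+* k} (hσ : σ x = x⁻¹) (n : ℤ) : σ (br x n) = -br x n := by
  simp [br, hσ]

/-- Every bracket changes sign under `σ`, so quotients of brackets are fixed. -/
theorem map_auxCoef {σ : k →+* k} (hσ : σ x = x⁻¹) (b j : ℕ) :
    σ (auxCoef x b j) = auxCoef x b j := by
  unfold auxCoef
  split_ifs
  · simp
  · rw [map_prod]
    refine Finset.prod_congr rfl fun i _ => ?_
    rw [map_div₀, map_neg, map_br hσ, map_br hσ, neg_neg, div_neg, neg_div]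

/-- For odd `a`, the difference between `canCoef` and its image is `br x (j - a) * auxCoef x (a + 1)
(j + 1) + br x (2 * j - (a + 1)) * auxCoef x (a + 1) j`, which vanishes by `auxCoef_succ` with `b =
a + 1`. -/
theorem map_canCoef (hx : ∀ n : ℤ, n ≠ 0 → x ^ n ≠ 1) (h0 : x ≠ 0) {σ : k →+* k}
    (hσ : σ x = x⁻¹) (a j : ℕ) : σ (canCoef x a j) = canCoef x a j := by
  unfold canCoef
  split_ifs
  · exact map_auxCoef hσ a j
  · have h := auxCoef_succ hx h0 (a + 1) j
    simp only [map_add, map_mul, map_zpow₀, hσ, map_auxCoef hσ, inv_zpow']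
    simp only [br] at h
    push_cast at h
    rw [show (j : ℤ) + 1 - (a + 1) = j - a by ring] at h
    linear_combination -h

/-- For odd `a` the two summands of `canCoef` match the two terms of the Pascal rule
`transCoef_succ_succ`, which raises `n` to `n + 1`. -/
theorem sum_canCoef_mul_transCoef (h0 : x ≠ 0) (a n : ℕ) :
    ∑ j ∈ Finset.range (n + 1), canCoef x a j * transCoef x n j =
      if n < a then 0 else canStdCoef x a (n - a) := by
  by_cases ha : Even a
  · simp only [canCoef, canStdCoef, if_pos ha]
    split_ifs with h
    · exact auxStdCoef_of_lt h
    · rw [Nat.add_sub_cancel' (not_lt.1 h)]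
      rfl
  · simp only [canCoef, canStdCoef, if_neg ha]
    have key : ∑ j ∈ Finset.range (n + 1), (x ^ ((j : ℤ) - a) * auxCoef x (a + 1) (j + 1) +
        x ^ (2 * (j : ℤ) - (a + 1)) * auxCoef x (a + 1) j) * transCoef x n j =
        x ^ ((n : ℤ) - a) * auxStdCoef x (a + 1) (n + 1) := by
      have e1 : ∀ j : ℕ, x ^ (2 * (j : ℤ) - (a + 1)) * auxCoef x (a + 1) j * transCoef x n j =
          x ^ ((n : ℤ) - a) * (x ^ (2 * (j : ℤ) - n - 1) * auxCoef x (a + 1) j * transCoef x n j) := by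
        intro j
        rw [show 2 * (j : ℤ) - (a + 1) = (n - a) + (2 * j - n - 1) by ring, zpow_add₀ h0]
        ring
      rw [auxStdCoef, Finset.sum_range_succ' _ (n + 1)]
      simp only [add_mul, Finset.sum_add_distrib, e1]
      rw [← Finset.mul_sum]
      -- Shift of `j` by one, so that both sums involve `auxCoef x (a + 1) (j + 1)`; the new top
      -- term is zero since `transCoef x n (n + 1) = 0`.
      have e2 : ∑ j ∈ Finset.range (n + 1),
          x ^ (2 * (j : ℤ) - n - 1) * auxCoef x (a + 1) j * transCoef x n j =
          ∑ j ∈ Finset.range (n + 1), x ^ (2 * (j : ℤ) + 1 - n) * auxCoef x (a + 1) (j + 1) *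
            transCoef x n (j + 1) + x ^ (-(n : ℤ) - 1) * auxCoef x (a + 1) 0 * transCoef x n 0 := by
        have := Finset.sum_range_succ' (fun j : ℕ =>
          x ^ (2 * (j : ℤ) - n - 1) * auxCoef x (a + 1) j * transCoef x n j) (n + 1)
        rw [Finset.sum_range_succ, transCoef_of_lt (Nat.lt_succ_self n), mul_zero, add_zero] at this
        rw [this]
        congr 1
        · refine Finset.sum_congr rfl fun j _ => ?_
          push_cast
          rw [show 2 * ((j : ℤ) + 1) - n - 1 = 2 * j + 1 - n by ring]
        · simp
      rw [e2, transCoef_succ_zero h0]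
      have e3 : ∑ j ∈ Finset.range (n + 1),
          x ^ ((j : ℤ) - a) * auxCoef x (a + 1) (j + 1) * transCoef x n j =
          x ^ ((n : ℤ) - a) * ∑ j ∈ Finset.range (n + 1),
            x ^ ((j : ℤ) - n) * auxCoef x (a + 1) (j + 1) * transCoef x n j := by
        rw [Finset.mul_sum]
        refine Finset.sum_congr rfl fun j _ => ?_
        rw [show (j : ℤ) - a = (n - a) + (j - n) by ring, zpow_add₀ h0]
        ring
      rw [e3, ← mul_add, ← add_assoc, ← Finset.sum_add_distrib]
      congr 2
      · refine Finset.sum_congr rfl fun j _ => ?_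
        rw [transCoef_succ_succ h0]
        ring
      · ring
    rw [key]
    split_ifs with h
    · rw [auxStdCoef_of_lt (by omega), mul_zero]
    · obtain ⟨i, rfl⟩ := Nat.exists_eq_add_of_le (not_lt.1 h)
      rw [Nat.add_sub_cancel_left, show a + 1 + i = a + i + 1 by ring]
      push_cast
      rw [add_sub_cancel_left, zpow_natCast]

theorem canStdCoef_zero (a : ℕ) : canStdCoef x a 0 = 1 := by
  unfold canStdCoef
  split_ifs <;> simp

theorem canStdCoef_of_even (hx : ∀ n : ℤ, n ≠ 0 → x ^ n ≠ 1) (h0 : x ≠ 0) {a : ℕ} (ha : Even a)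
    (s : ℕ) :
    canStdCoef x a (2 * s) = x ^ (-2 * (s : ℤ) ^ 2 - s) * closedProd x a s ∧
    canStdCoef x a (2 * s + 1) =
      x ^ (-(a : ℤ) - 2 * (s : ℤ) ^ 2 - 3 * s - 1) * closedProd x a s := by
  simp only [canStdCoef, if_pos ha]
  exact auxStdCoef_closed hx h0 a s

theorem canStdCoef_of_odd (hx : ∀ n : ℤ, n ≠ 0 → x ^ n ≠ 1) (h0 : x ≠ 0) {a : ℕ} (ha : Odd a)
    (s : ℕ) :
    canStdCoef x a (2 * s) = x ^ (-2 * (s : ℤ) ^ 2 + s) * closedProd x (a + 1) s ∧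
    canStdCoef x a (2 * s + 1) =
      x ^ (-(a : ℤ) - 2 * (s : ℤ) ^ 2 - s - 1) * closedProd x (a + 1) s := by
  simp only [canStdCoef, if_neg (Nat.not_even_iff_odd.2 ha)]
  obtain ⟨h1, h2⟩ := auxStdCoef_closed hx h0 (a + 1) s
  rw [h1, h2]
  constructor <;> rw [← mul_assoc, ← zpow_natCast, ← zpow_add₀ h0] <;> congr 2 <;> push_cast <;> ring

/-- For `b = 2 * m` the numerators are `1 - x ^ (-4 * (m + i))`, of the same kind as the
denominators. This integrality is why odd `a` is treated through `b = a + 1`. -/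
theorem closedProd_eq_gaussBinom (hx : ∀ n : ℤ, n ≠ 0 → x ^ n ≠ 1) (m s : ℕ) :
    closedProd x (2 * m) s = gaussBinom (x⁻¹ ^ 4) (m + s) s := by
  induction s with
  | zero => simp [closedProd]
  | succ s ih =>
    have hd : 1 - x ^ (-4 * (s + 1 : ℤ)) ≠ 0 :=
      sub_ne_zero.2 (hx _ (by omega)).symm
    have h := gaussBinom_absorb (x⁻¹ ^ 4) (m + s) s
    have e (n : ℕ) : (x⁻¹ ^ 4) ^ n = x ^ (-4 * (n : ℤ)) := by
      rw [← pow_mul, inv_pow, zpow_mul, zpow_natCast, zpow_neg, inv_pow, pow_mul,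
        zpow_ofNat]
    rw [closedProd_succ, ih, mul_div_assoc', div_eq_iff hd]
    rw [e, e] at h
    push_cast at h ⊢
    rw [show -2 * (2 * (m : ℤ)) - 4 * (s + 1) = -4 * (m + s + 1) by ring]
    rw [← add_assoc]
    linear_combination h

/-- The coefficients of a canonical basis element, except for the leading one, lie in
`x⁻¹ ℤ[x⁻¹]`. -/
theorem exists_canStdCoef_eq (hx : ∀ n : ℤ, n ≠ 0 → x ^ n ≠ 1) (h0 : x ≠ 0) (a : ℕ) {i : ℕ}
    (hi : 0 < i) : ∃ p : Polynomial ℤ,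
      canStdCoef x a i = x⁻¹ * p.eval₂ (Int.castRingHom k) x⁻¹ := by
  -- As the product is a polynomial in `x⁻¹`, only the sign of the prefactor's exponent remains to
  -- be checked.
  have main : ∀ (e : ℤ) (m s : ℕ), e < 0 → ∃ p : Polynomial ℤ,
      x ^ e * closedProd x (2 * m) s = x⁻¹ * p.eval₂ (Int.castRingHom k) x⁻¹ := by
    intro e m s he
    obtain ⟨n, hn⟩ := Int.eq_ofNat_of_zero_le (show 0 ≤ -e - 1 by omega)
    refine ⟨Polynomial.X ^ n * gaussBinom (Polynomial.X ^ 4) (m + s) s, ?_⟩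
    rw [closedProd_eq_gaussBinom hx, ← Polynomial.coe_eval₂RingHom, map_mul, map_gaussBinom,
      map_pow, map_pow, Polynomial.coe_eval₂RingHom, Polynomial.eval₂_X,
      show e = -((n + 1 : ℕ) : ℤ) by push_cast; omega, zpow_neg, zpow_natCast, ← inv_pow, pow_succ']
    ring
  rcases Nat.even_or_odd a with ha | ha
  · obtain ⟨m, rfl⟩ := ha.two_dvd
    rcases Nat.even_or_odd' i with ⟨s, rfl | rfl⟩
    · rw [(canStdCoef_of_even hx h0 ha s).1]
      exact main _ _ _ (by nlinarith)
    · rw [(canStdCoef_of_even hx h0 ha s).2]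
      exact main _ _ _ (by nlinarith)
  · obtain ⟨m, hm⟩ := (ha.add_odd odd_one).two_dvd
    rcases Nat.even_or_odd' i with ⟨s, rfl | rfl⟩
    · rw [(canStdCoef_of_odd hx h0 ha s).1, hm]
      have hs : (0 : ℤ) < s := by omega
      exact main _ _ _ (by nlinarith)
    · rw [(canStdCoef_of_odd hx h0 ha s).2, hm]
      exact main _ _ _ (by nlinarith)

end Canonical

/-! ### Powers of `v` -/

theorem v_ne_zero : v ≠ 0 := by
  rw [v, Ne, IsFractionRing.to_map_eq_zero_iff]
  exact (LaurentPolynomial.isUnit_T 1).ne_zero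

theorem v_zpow (n : ℤ) : v ^ n = algebraMap A K (vpow n) := by
  have hnat : ∀ m : ℕ, v ^ m = algebraMap A K (vpow m) := fun m => by
    rw [v, ← map_pow, vpow, LaurentPolynomial.T_pow, mul_one]
  obtain ⟨m, rfl | rfl⟩ := n.eq_nat_or_neg
  · rw [zpow_natCast, hnat]
  · rw [zpow_neg, zpow_natCast, hnat]
    refine inv_eq_of_mul_eq_one_right ?_
    rw [← map_mul, ← LaurentPolynomial.T_add]
    simp

theorem v_zpow_ne_one (n : ℤ) (hn : n ≠ 0) : v ^ n ≠ 1 := by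
  rw [v_zpow, ← map_one (algebraMap A K)]
  intro h
  have h1 := IsFractionRing.injective A K h
  rw [vpow, ← LaurentPolynomial.T_zero] at h1
  have h2 := congrArg (fun p : A => p.coeff n) h1
  simp only [LaurentPolynomial.T_apply] at h2
  simp [hn.symm] at h2

/-- The coefficients of the monomial basis in the standard basis, in the integral form. -/
def transInt (n j : ℕ) : A :=
  vpow (((j + 1).choose 2 : ℤ) - ((n + 1).choose 2 : ℤ)) * gaussBinom (vpow 2) n j

theorem algebraMap_transInt (n j : ℕ) : algebraMap A K (transInt n j) = transCoef v n j := by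
  rw [transInt, transCoef, map_mul, map_gaussBinom, v_zpow, ← v_zpow 2]
  rfl

theorem spec_vpow (q : OddPrimePower) (n : ℤ) : spec q (vpow n) = Real.sqrt q.card ^ n := by
  rw [spec, vpow, LaurentPolynomial.eval₂_T]
  simp

theorem card_Fq (q : OddPrimePower) [Fintype (Fq q)] : Fintype.card (Fq q) = q.card := by
  rw [← Nat.card_eq_fintype_card, GaloisField.card _ _ q.pos.ne']
  rfl

theorem spec_transInt (q : OddPrimePower) (n j : ℕ) :
    spec q (transInt n j) =
      Real.sqrt q.card ^ (((j + 1).choose 2 : ℤ) - ((n + 1).choose 2 : ℤ)) *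
        gaussBinom (q.card : ℝ) n j := by
  rw [transInt, map_mul, map_gaussBinom, spec_vpow, spec_vpow, zpow_ofNat,
    Real.sq_sqrt (Nat.cast_nonneg _)]

/-! ### The monomial basis elements in terms of the standard basis -/

theorem conv_apply {d a b c : ℕ} (f : Corr d a b) (g : Corr d b c) (q : OddPrimePower)
    (W : Iso q d a) (W' : Iso q d c) : conv f g q W W' = ∑ U, f q W U * g q U W' := rfl

theorem sum_apply {d a b : ℕ} {ι : Type*} (s : Finset ι) (f : ι → Corr d a b) (q : OddPrimePower)
    (W : Iso q d a) (W' : Iso q d b) : (∑ i ∈ s, f i) q W W' = ∑ i ∈ s, f i q W W' := by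
  classical
  induction s using Finset.induction_on with
  | empty => rfl
  | insert i s hi ih => rw [Finset.sum_insert hi, Finset.sum_insert hi, add_apply, ih]

theorem orbit_apply (d a : ℕ) (q : OddPrimePower) (L L' : Iso q d d) [Decidable
    (Module.finrank (Fq q) ↥(L.1 ⊓ L'.1) = a)] :
    orbit d a q L L' = if Module.finrank (Fq q) ↥(L.1 ⊓ L'.1) = a then 1 else 0 := by
  simp only [orbit, Matrix.of_apply]
  congr

theorem choose_add_succ_two (a b : ℕ) :
    (a + b + 1).choose 2 = a * b + (a + 1).choose 2 + (b + 1).choose 2 := by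
  have h (n : ℕ) : 2 * (n + 1).choose 2 = (n + 1) * n := by
    rw [Nat.choose_two_right, Nat.mul_div_cancel' (Nat.even_mul_pred_self (n + 1)).two_dvd,
      Nat.add_sub_cancel]
  have h1 := h a
  have h2 := h b
  have h3 := h (a + b)
  nlinarith

theorem finrank_inf_le {q : OddPrimePower} {d : ℕ} (L L' : Iso q d d) :
    Module.finrank (Fq q) ↥(L.1 ⊓ L'.1) ≤ d :=
  (Submodule.finrank_mono inf_le_left).trans_eq L.2.1

/-- Subspaces of an isotropic space are isotropic, so `U` ranges over all `j`-dimensional subspaces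
of `L ∩ L'`. -/
theorem sum_incidence_mul {q : OddPrimePower} {d j : ℕ} (L L' : Iso q d d) :
    ∑ U, incidence d j q L U * coincidence d j q U L' =
      gaussBinom (q.card : ℝ) (Module.finrank (Fq q) ↥(L.1 ⊓ L'.1)) j := by
  classical
  have : Fintype (Fq q) := Fintype.ofFinite _
  rw [← card_Fq, ← card_submodule_le]
  simp only [incidence, coincidence, Matrix.of_apply, ← ite_and, mul_ite, mul_one, mul_zero]
  rw [Finset.sum_boole, ← Fintype.card_subtype, ← Nat.card_eq_fintype_card]
  congr 1
  refine Nat.card_congr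
    { toFun := fun U => ⟨U.1.1, U.1.2.1, le_inf U.2.2 U.2.1⟩
      invFun := fun W => ⟨⟨W.1, W.2.1, fun x hx y hy =>
        L.2.2 x (W.2.2 hx).1 y (W.2.2 hy).1⟩, W.2.2.trans inf_le_right, W.2.2.trans inf_le_left⟩
      left_inv := fun U => rfl
      right_inv := fun W => rfl }

theorem mono_eq_sum {d j : ℕ} (hj : j ≤ d) :
    mono d j (d - j) = ∑ n ∈ Finset.range (d + 1), transInt n j • std d n (d - n) := by
  classical
  funext q
  ext L L'
  have h0 := sqrt_card_ne_zero q
  obtain ⟨r, rfl⟩ := Nat.exists_eq_add_of_le hj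
  rw [sum_apply, mono, conv_apply]
  simp only [down, up, std, smul_apply, orbit_apply, spec_vpow, mul_ite, mul_one, mul_zero]
  rw [Finset.sum_ite_eq, if_pos (by simpa [Nat.lt_succ_iff] using finrank_inf_le L L')]
  simp only [mul_mul_mul_comm _ (incidence _ _ _ _ _)]
  rw [← Finset.mul_sum, sum_incidence_mul, spec_transInt, ← zpow_add₀ h0]
  obtain ⟨i, hi⟩ := Nat.exists_eq_add_of_le (finrank_inf_le L L')
  rw [Nat.add_sub_cancel_left, show j + r - Module.finrank (Fq q) ↥(L.1 ⊓ L'.1) = i by omega,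
    mul_right_comm, ← zpow_add₀ h0]
  congr 2
  -- Both normalizing exponents are rewritten relative to `(d + 1).choose 2`, which cancels; hence
  -- the coefficients do not depend on `d`.
  have h1 := choose_add_succ_two j r
  have h2 := choose_add_succ_two (Module.finrank (Fq q) ↥(L.1 ⊓ L'.1)) i
  rw [← hi] at h2
  zify at h1 h2
  push_cast
  linarith

/-! ### Linear independence of the standard basis -/

/-- The subspace of vectors supported on a given set of coordinates. -/
def coordSubspace (q : OddPrimePower) (d : ℕ) (s : Set (Fin (2 * d + 1))) :
    Submodule (Fq q) (V q d) :=
  ⨅ i ∈ sᶜ, LinearMap.ker (LinearMap.proj i : V q d →ₗ[Fq q] Fq q)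

theorem mem_coordSubspace {q : OddPrimePower} {d : ℕ} {s : Set (Fin (2 * d + 1))} {x : V q d} :
    x ∈ coordSubspace q d s ↔ ∀ i, i ∉ s → x i = 0 := by
  simp [coordSubspace, Submodule.mem_iInf]

theorem coordSubspace_inf (q : OddPrimePower) (d : ℕ) (s t : Set (Fin (2 * d + 1))) :
    coordSubspace q d s ⊓ coordSubspace q d t = coordSubspace q d (s ∩ t) := by
  ext x
  simp only [Submodule.mem_inf, mem_coordSubspace, Set.mem_inter_iff]
  grind

theorem finrank_coordSubspace (q : OddPrimePower) (d : ℕ) (p : ℕ → Prop) [DecidablePred p] :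
    Module.finrank (Fq q) (coordSubspace q d {i | p i.val}) =
      ((Finset.range (2 * d + 1)).filter p).card := by
  have e := LinearMap.iInfKerProjEquiv (Fq q) (fun _ : Fin (2 * d + 1) => Fq q)
    (I := {i | p i.val}) (J := {i | p i.val}ᶜ) disjoint_compl_right (by simp)
  rw [coordSubspace, e.finrank_eq, Module.finrank_fintype_fun_eq_card, Finset.card_filter,
    ← Fin.sum_univ_eq_sum_range (fun i => if p i then 1 else 0), ← Finset.card_filter]
  exact Fintype.card_subtype _

theorem form_eq_zero_of_mem_coordSubspace {q : OddPrimePower} {d : ℕ} {s : Set (Fin (2 * d + 1))}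
    (hs : ∀ i ∈ s, Fin.rev i ∉ s) {x y : V q d} (hx : x ∈ coordSubspace q d s)
    (hy : y ∈ coordSubspace q d s) : form q d x y = 0 := by
  refine Finset.sum_eq_zero fun i _ => ?_
  by_cases hi : i ∈ s
  · rw [mem_coordSubspace.1 hy _ (hs i hi), mul_zero]
  · rw [mem_coordSubspace.1 hx _ hi, zero_mul]

/-- The form pairs coordinate `i` with `2 * d - i`. `L` uses the coordinates below `d`; `L'` keeps
the first `a` of them and replaces the others by their partners, avoiding the self-paired coordinate
`d`. -/
theorem exists_finrank_inf_eq (q : OddPrimePower) {d a : ℕ} (ha : a ≤ d) :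
    ∃ L L' : Iso q d d, Module.finrank (Fq q) ↥(L.1 ⊓ L'.1) = a := by
  refine ⟨⟨coordSubspace q d {i | i.val < d}, ?_, fun x hx y hy =>
      form_eq_zero_of_mem_coordSubspace (fun i hi => ?_) hx hy⟩,
    ⟨coordSubspace q d {i | i.val < a ∨ d < i.val ∧ i.val ≤ 2 * d - a}, ?_, fun x hx y hy =>
      form_eq_zero_of_mem_coordSubspace (fun i hi => ?_) hx hy⟩, ?_⟩
  · rw [finrank_coordSubspace q d (fun i => i < d),
      show (Finset.range (2 * d + 1)).filter (fun i => i < d) = Finset.range d by ext; simp; omega,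
      Finset.card_range]
  · simp only [Set.mem_ofPred_eq, Fin.val_rev] at hi ⊢
    omega
  · rw [finrank_coordSubspace q d (fun i => i < a ∨ d < i ∧ i ≤ 2 * d - a),
      show (Finset.range (2 * d + 1)).filter (fun i => i < a ∨ d < i ∧ i ≤ 2 * d - a) =
        Finset.range a ∪ Finset.Ioc d (2 * d - a) by ext; simp; omega,
      Finset.card_union_of_disjoint, Finset.card_range, Nat.card_Ioc]
    · omega
    · rw [Finset.disjoint_left]
      simp
      omega
  · simp only [Set.mem_ofPred_eq, Fin.val_rev] at hi ⊢
    omega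
  · dsimp only
    rw [coordSubspace_inf, show {i : Fin (2 * d + 1) | i.val < d} ∩
        {i | i.val < a ∨ d < i.val ∧ i.val ≤ 2 * d - a} = {i | i.val < a} by ext; simp; omega,
      finrank_coordSubspace q d (fun i => i < a),
      show (Finset.range (2 * d + 1)).filter (fun i => i < a) = Finset.range a by ext; simp; omega,
      Finset.card_range]

/-- The prime powers `3 ^ (n + 1)`. -/
def threePow (n : ℕ) : OddPrimePower := ⟨3, n + 1, ⟨Nat.prime_three⟩, by decide, n.succ_pos⟩

/-- An element of `𝒜` is determined by its specializations. -/
theorem eq_zero_of_spec_eq_zero (p : A) (h : ∀ q, spec q p = 0) : p = 0 := by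
  obtain ⟨n, f, hf⟩ := LaurentPolynomial.exists_T_pow p
  -- After multiplication by a power of `v`, a polynomial remains that has the infinitely many roots
  -- `√(3 ^ (m + 1))`.
  have hroot (m : ℕ) : (f.map (Int.castRingHom ℝ)).IsRoot (Real.sqrt (threePow m).card) := by
    have h1 := congrArg (spec (threePow m)) hf
    rw [map_mul, h, zero_mul, spec, LaurentPolynomial.eval₂_toLaurent] at h1
    rwa [Polynomial.IsRoot, Polynomial.eval_map]
  have hinj : Function.Injective fun m : ℕ => Real.sqrt (threePow m).card := by
    intro m m' hm
    have h2 := (Real.sqrt_inj (Nat.cast_nonneg _) (Nat.cast_nonneg _)).1 hm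
    have h3 := Nat.pow_right_injective (le_of_eq_of_le rfl (by decide : 2 ≤ 3)) (Nat.cast_injective h2)
    exact Nat.succ_injective h3
  have hz : f.map (Int.castRingHom ℝ) = 0 :=
    Polynomial.eq_zero_of_infinite_isRoot _ ((Set.infinite_range_of_injective hinj).mono
      (by rintro _ ⟨m, rfl⟩; exact hroot m))
  rw [Polynomial.map_eq_zero_iff (RingHom.injective_int _)] at hz
  rw [hz, map_zero] at hf
  exact ((LaurentPolynomial.isUnit_T (n : ℤ)).mul_left_eq_zero.1 hf.symm)

/-- Evaluating a relation at a pair in the `n`-th orbit isolates the `n`-th coefficient at every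
`q`; these values determine a Laurent polynomial. -/
theorem linearIndependent_std (d : ℕ) :
    LinearIndependent A fun n : Fin (d + 1) => std d n (d - n) := by
  classical
  rw [Fintype.linearIndependent_iff]
  intro g hg n
  refine eq_zero_of_spec_eq_zero _ fun q => ?_
  obtain ⟨L, L', hL⟩ := exists_finrank_inf_eq q (Nat.lt_succ_iff.1 n.2)
  have h := congrFun (congrFun (congrFun hg q) L) L'
  rw [sum_apply] at h
  simp only [std, smul_apply, orbit_apply, hL, Fin.val_inj, mul_ite, mul_one, mul_zero,
    Finset.sum_ite_eq, Finset.mem_univ, if_true] at h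
  refine (mul_eq_zero.1 (h.trans rfl)).resolve_right ?_
  rw [spec_vpow]
  exact zpow_ne_zero _ (sqrt_card_ne_zero q)

/-- The standard basis of the integral form. -/
def intBasis (d : ℕ) : Module.Basis (Fin (d + 1)) A (SInt d) :=
  Module.Basis.mk (v := fun n : Fin (d + 1) =>
      (⟨std d n (d - n), std_mem (Nat.add_sub_cancel' (Nat.lt_succ_iff.1 n.2))⟩ : SInt d))
    (LinearIndependent.of_comp (SInt d).subtype (linearIndependent_std d)) (by
      rw [top_le_iff, ← Submodule.map_injective_of_injective (SInt d).injective_subtype |>.eq_iff]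
      rw [Submodule.map_span, Submodule.map_top, Submodule.range_subtype, ← Set.range_comp]
      congr 1
      ext x
      constructor
      · rintro ⟨n, rfl⟩
        exact ⟨n, d - n, Nat.add_sub_cancel' (Nat.lt_succ_iff.1 n.2), rfl⟩
      · rintro ⟨a, b, rfl, rfl⟩
        exact ⟨⟨a, by omega⟩, by simp⟩)

/-- The standard basis of `S^ı(2,d)`. -/
def stdBasis (d : ℕ) : Module.Basis (Fin (d + 1)) K (S d) :=
  Algebra.TensorProduct.basis K (intBasis d)

theorem stdBasis_apply (d : ℕ) (n : Fin (d + 1)) : stdBasis d n = basisElt d n (d - n) := by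
  rw [stdBasis, Algebra.TensorProduct.basis_apply, intBasis, Module.Basis.mk_apply, basisElt,
    dif_pos (Nat.add_sub_cancel' (Nat.lt_succ_iff.1 n.2))]
  rfl

/-! ### The monomial basis and the bar involution -/

theorem mono_mem {d j : ℕ} (hj : j ≤ d) : mono d j (d - j) ∈ SInt d := by
  rw [mono_eq_sum hj]
  exact Submodule.sum_mem _ fun n hn => Submodule.smul_mem _ _
    (std_mem (Nat.add_sub_cancel' (Nat.lt_succ_iff.1 (Finset.mem_range.1 hn))))

/-- The monomial basis elements, in the integral form. -/
def monoInt (d : ℕ) (j : Fin (d + 1)) : SInt d :=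
  ⟨mono d j (d - j), mono_mem (Nat.lt_succ_iff.1 j.2)⟩

theorem ofInt_monoInt (d : ℕ) (j : Fin (d + 1)) :
    ofInt (monoInt d j) = ∑ n : Fin (d + 1), transCoef v n j • stdBasis d n := by
  have h : monoInt d j = ∑ n : Fin (d + 1), transInt n j • intBasis d n := by
    apply Subtype.ext
    refine (mono_eq_sum (Nat.lt_succ_iff.1 j.2)).trans ?_
    rw [← Fin.sum_univ_eq_sum_range
      (fun n => transInt n j • std d n (d - n))]
    simp [intBasis]
  rw [h, ofInt, map_sum]
  refine Finset.sum_congr rfl fun n _ => ?_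
  rw [map_smul, ← algebraMap_transInt, algebraMap_smul, stdBasis, Algebra.TensorProduct.basis_apply]
  rfl

theorem isUnit_det_mono (d : ℕ) : IsUnit ((stdBasis d).det fun j => ofInt (monoInt d j)) := by
  have hM : (stdBasis d).toMatrix (fun j => ofInt (monoInt d j)) =
      Matrix.of fun n j : Fin (d + 1) => transCoef v n j := by
    ext n j
    simp [Module.Basis.toMatrix_apply, ofInt_monoInt, Finsupp.single_apply]
  rw [Module.Basis.det_apply, hM, Matrix.det_of_isLowerTriangular]
  · simp
  · intro n j h
    exact transCoef_of_lt h

/-- The monomial basis of `S^ı(2,d)`. -/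
def monoBasis (d : ℕ) : Module.Basis (Fin (d + 1)) K (S d) :=
  Module.Basis.mk (((stdBasis d).is_basis_iff_det).2 (isUnit_det_mono d)).1
    (((stdBasis d).is_basis_iff_det).2 (isUnit_det_mono d)).2.ge

theorem monoBasis_apply (d : ℕ) (j : Fin (d + 1)) : monoBasis d j = ofInt (monoInt d j) :=
  Module.Basis.mk_apply _ _ _

theorem monoBasis_eq_sum (d : ℕ) (j : Fin (d + 1)) :
    monoBasis d j = ∑ n : Fin (d + 1), transCoef v n j • stdBasis d n := by
  rw [monoBasis_apply, ofInt_monoInt]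

theorem isBar_iff {d : ℕ} {bar : S d →ₛₗ[barK] S d} :
    IsBar d bar ↔ ∀ j, bar (monoBasis d j) = monoBasis d j := by
  constructor
  · intro h j
    obtain ⟨m, hm, hbar⟩ := h j (d - j) (Nat.add_sub_cancel' (Nat.lt_succ_iff.1 j.2))
    rw [monoBasis_apply, show monoInt d j = m from Subtype.ext hm.symm, hbar]
  · rintro h a r rfl
    refine ⟨monoInt (a + r) ⟨a, by omega⟩, by simp [monoInt], ?_⟩
    rw [← monoBasis_apply, h]

/-- The semilinear map that fixes the monomial basis. -/
def barMap (d : ℕ) : S d →ₛₗ[barK] S d where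
  toFun x := ∑ j, barK ((monoBasis d).repr x j) • monoBasis d j
  map_add' x y := by simp [add_smul, Finset.sum_add_distrib]
  map_smul' c x := by simp [mul_smul, Finset.smul_sum]

theorem existsUnique_isBar (d : ℕ) : ∃! bar : S d →ₛₗ[barK] S d, IsBar d bar := by
  refine ⟨barMap d, isBar_iff.2 fun j => ?_, fun bar h => (monoBasis d).ext fun j => ?_⟩
  · simp [barMap, Finsupp.single_apply]
  · rw [isBar_iff.1 h j]
    simp [barMap, Finsupp.single_apply]

/-- Bar invariance means bar invariance of the coefficients in the monomial basis. -/
theorem bar_eq_self_iff {d : ℕ} {bar : S d →ₛₗ[barK] S d} (h : IsBar d bar) (x : S d) :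
    bar x = x ↔ ∀ j, barK ((monoBasis d).repr x j) = (monoBasis d).repr x j := by
  have hx : bar x = ∑ j, barK ((monoBasis d).repr x j) • monoBasis d j := by
    conv_lhs => rw [← (monoBasis d).sum_repr x]
    rw [map_sum]
    refine Finset.sum_congr rfl fun j _ => ?_
    rw [map_smulₛₗ, isBar_iff.1 h]
  constructor
  · intro hb j
    rw [hx] at hb
    conv_rhs => rw [← hb]
    simp [Finsupp.single_apply]
  · intro hb
    rw [hx]
    simp only [hb]
    exact (monoBasis d).sum_repr x

/-! ### Uniqueness -/

theorem eq_zero_of_isNegative {g : K} (hg : IsNegative g) (hbar : barK g = g) : g = 0 := by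
  obtain ⟨p, rfl⟩ := hg
  have h1 : v * Polynomial.aeval v p = v⁻¹ * Polynomial.aeval v⁻¹ p := by
    rw [← hbar, map_mul, map_inv₀, barK_v, inv_inv]
    congr 1
    rw [Polynomial.aeval_def, Polynomial.aeval_def, Polynomial.hom_eval₂, map_inv₀, barK_v, inv_inv]
    congr 1
    exact Subsingleton.elim _ _
  have h2 (n : ℤ) : Polynomial.aeval (v ^ n) p =
      algebraMap A K (Polynomial.aeval (vpow n) p) := by
    rw [v_zpow, Polynomial.aeval_algebraMap_apply]
  have h3 : vpow 1 * Polynomial.aeval (vpow 1) p = vpow (-1) * Polynomial.aeval (vpow (-1)) p := by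
    apply IsFractionRing.injective A K
    rw [map_mul, map_mul, ← h2, ← h2, ← v_zpow, ← v_zpow, zpow_one, zpow_neg_one, h1]
  have h4 : vpow 1 * Polynomial.aeval (vpow 1) p =
      Polynomial.toLaurentAlg (Polynomial.X * p) := by
    rw [← Polynomial.aeval_X_left_apply (Polynomial.X * p), ← Polynomial.aeval_algHom_apply,
      Polynomial.toLaurentAlg_apply, Polynomial.toLaurent_X, map_mul, Polynomial.aeval_X]
  have h5 : vpow (-1) * Polynomial.aeval (vpow (-1)) p =
      LaurentPolynomial.invert (Polynomial.toLaurentAlg (Polynomial.X * p)) := by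
    rw [← h4, map_mul, vpow, LaurentPolynomial.invert_T, ← Polynomial.aeval_algHom_apply,
      LaurentPolynomial.invert_T]
  rw [h4, h5, Polynomial.toLaurentAlg_apply] at h3
  -- By `h3`, the polynomial `X * p` equals its image under `v ↦ v⁻¹`; the former has only positive
  -- exponents, the latter only negative ones.
  have h6 : p = 0 := by
    ext n
    have h7 := congrArg (fun f : A => f.coeff (n + 1 : ℕ)) h3
    simp only [LaurentPolynomial.invert_apply, LaurentPolynomial.coeff_toLaurent] at h7
    rw [Finsupp.mapDomain_of_notMem_range _ (-((n + 1 : ℕ) : ℤ)) (by simp; omega)] at h7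
    have h8 := Finsupp.mapDomain_apply (Nat.castEmbedding (R := ℤ)).injective
      (Polynomial.X * p).toFinsupp.coeff (n + 1)
    rw [Nat.castEmbedding_apply, h7] at h8
    have h9 : (Polynomial.X * p).coeff (n + 1) = 0 := h8.symm
    rwa [Polynomial.coeff_X_mul] at h9
  rw [h6, map_zero, mul_zero]

/-- An element whose coefficients in the standard basis are all in `v⁻¹ ℤ[v⁻¹]` is zero if it is
bar invariant. -/
theorem eq_zero_of_bar_eq_self {d : ℕ} {bar : S d →ₛₗ[barK] S d} (h : IsBar d bar) {x : S d}
    (hx : bar x = x) (hneg : ∀ n, IsNegative ((stdBasis d).repr x n)) : x = 0 := by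
  rw [bar_eq_self_iff h] at hx
  have hrel (n : Fin (d + 1)) : (stdBasis d).repr x n =
      ∑ j : Fin (d + 1), (monoBasis d).repr x j * transCoef v n j := by
    conv_lhs => rw [← (monoBasis d).sum_repr x]
    simp [monoBasis_eq_sum, Finsupp.single_apply]
  -- Once the monomial coefficients below `n` vanish, unitriangularity makes the monomial and
  -- standard coefficients at `n` equal, hence both bar invariant and negative.
  have hzero (n : Fin (d + 1)) : (monoBasis d).repr x n = 0 := by
    induction n using WellFoundedLT.induction with
    | ind n ih =>
      have h1 : (stdBasis d).repr x n = (monoBasis d).repr x n := by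
        rw [hrel, Finset.sum_eq_single n]
        · rw [transCoef_self, mul_one]
        · intro j _ hj
          rcases lt_or_gt_of_ne hj with hlt | hgt
          · rw [ih j hlt, zero_mul]
          · rw [transCoef_of_lt hgt, mul_zero]
        · simp
      exact eq_zero_of_isNegative (h1 ▸ hneg n) (hx n)
  apply (monoBasis d).repr.injective
  ext n
  rw [hzero]
  simp

/-! ### The canonical basis -/

theorem repr_sum_basisElt {a r d : ℕ} (h : a + r = d) (f : ℕ → K) (n : Fin (d + 1)) :
    (stdBasis d).repr (∑ i ∈ Finset.range (r + 1), f i • basisElt d (a + i) (r - i)) n =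
      if (n : ℕ) < a then 0 else f (n - a) := by
  have hi (i : ℕ) (hi : i ∈ Finset.range (r + 1)) : (stdBasis d).repr
      (f i • basisElt d (a + i) (r - i)) n = if a + i = n then f i else 0 := by
    rw [Finset.mem_range] at hi
    have hb : basisElt d (a + i) (r - i) = stdBasis d ⟨a + i, by omega⟩ := by
      rw [stdBasis_apply]
      congr 1
      dsimp only
      omega
    rw [hb, map_smul, Module.Basis.repr_self, Finsupp.smul_apply, Finsupp.single_apply, smul_eq_mul,
      mul_ite, mul_one, mul_zero]
    simp only [Fin.ext_iff]
  rw [map_sum, Finset.sum_apply', Finset.sum_congr rfl hi]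
  split_ifs with hn
  · exact Finset.sum_eq_zero fun i _ => if_neg (by omega)
  · rw [Finset.sum_eq_single ((n : ℕ) - a)]
    · exact if_pos (by omega)
    · intro i _ hi
      exact if_neg (by omega)
    · intro hmem
      rw [Finset.mem_range] at hmem
      omega

theorem sum_range_basisElt {a r d : ℕ} (f : ℕ → K) (hf : f 0 = 1) :
    ∑ i ∈ Finset.range (r + 1), f i • basisElt d (a + i) (r - i) =
      basisElt d a r + ∑ i ∈ Finset.Icc 1 r, f i • basisElt d (a + i) (r - i) := by
  rw [Finset.range_eq_Ico, Finset.sum_eq_sum_Ico_succ_bot (Nat.succ_pos r), hf, one_smul]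
  rfl

theorem sum_canStdCoef_eq {a r d : ℕ} (h : a + r = d) :
    ∑ i ∈ Finset.range (r + 1), canStdCoef v a i • basisElt d (a + i) (r - i) =
      ∑ j : Fin (d + 1), canCoef v a j • monoBasis d j := by
  apply (stdBasis d).repr.injective
  ext n
  rw [repr_sum_basisElt h, ← sum_canCoef_mul_transCoef v_ne_zero,
    Finset.sum_subset (Finset.range_subset_range.2 n.2), ← Fin.sum_univ_eq_sum_range
      (fun j => canCoef v a j * transCoef v n j)]
  · simp [monoBasis_eq_sum, Finsupp.single_apply]
  · intro j _ hj
    rw [transCoef_of_lt (by simpa using hj), mul_zero]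

theorem bar_sum_canStdCoef {a r d : ℕ} (h : a + r = d) {bar : S d →ₛₗ[barK] S d}
    (hbar : IsBar d bar) :
    bar (∑ i ∈ Finset.range (r + 1), canStdCoef v a i • basisElt d (a + i) (r - i)) =
      ∑ i ∈ Finset.range (r + 1), canStdCoef v a i • basisElt d (a + i) (r - i) := by
  rw [bar_eq_self_iff hbar, sum_canStdCoef_eq h]
  intro j
  simpa [Finsupp.single_apply] using
    map_canCoef v_zpow_ne_one v_ne_zero barK_v a j

theorem IsNegative.sub {f g : K} (hf : IsNegative f) (hg : IsNegative g) : IsNegative (f - g) := by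
  obtain ⟨p, rfl⟩ := hf
  obtain ⟨p', rfl⟩ := hg
  exact ⟨p - p', by rw [map_sub, mul_sub]⟩

theorem isNegative_zero : IsNegative 0 := ⟨0, by simp⟩

theorem isNegative_canStdCoef (a : ℕ) {i : ℕ} (hi : 0 < i) : IsNegative (canStdCoef v a i) := by
  obtain ⟨p, hp⟩ := exists_canStdCoef_eq v_zpow_ne_one v_ne_zero a hi
  refine ⟨p, hp.trans ?_⟩
  rw [Polynomial.aeval_def, Subsingleton.elim (algebraMap ℤ K) (Int.castRingHom K)]

theorem isCanonical_iff {a r d : ℕ} (h : a + r = d) {bar : S d →ₛₗ[barK] S d}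
    (hbar : IsBar d bar) (x : S d) :
    IsCanonical d bar a r x ↔
      x = ∑ i ∈ Finset.range (r + 1), canStdCoef v a i • basisElt d (a + i) (r - i) := by
  constructor
  · rintro ⟨hx, g, hg, hxg⟩
    -- `IsCanonical` leaves `g 0` arbitrary, so it is replaced by the leading coefficient `1`.
    have hxf : x = ∑ i ∈ Finset.range (r + 1),
        (if i = 0 then 1 else g i) • basisElt d (a + i) (r - i) := by
      rw [sum_range_basisElt _ (if_pos rfl), hxg]
      congr 1
      refine Finset.sum_congr rfl fun i hi => ?_
      rw [if_neg (by rw [Finset.mem_Icc] at hi; omega)]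
    rw [← sub_eq_zero]
    refine eq_zero_of_bar_eq_self hbar (by rw [map_sub, hx, bar_sum_canStdCoef h hbar]) fun n => ?_
    rw [map_sub, Finsupp.sub_apply, hxf, repr_sum_basisElt h, repr_sum_basisElt h]
    split_ifs with h1 h2
    · rw [sub_zero]
      exact isNegative_zero
    · rw [h2, canStdCoef_zero, sub_self]
      exact isNegative_zero
    · exact (hg _ (Finset.mem_Icc.2 (by omega))).sub (isNegative_canStdCoef a (by omega))
  · rintro rfl
    exact ⟨bar_sum_canStdCoef h hbar, canStdCoef v a,
      fun i hi => isNegative_canStdCoef a (Finset.mem_Icc.1 hi).1,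
      sum_range_basisElt _ (canStdCoef_zero a)⟩

theorem standard_basis (d : ℕ) :
    LinearIndependent K (fun b : Fin (d + 1) => basisElt d (d - (b : ℕ)) (b : ℕ)) ∧
      Submodule.span K (Set.range (fun b : Fin (d + 1) => basisElt d (d - (b : ℕ)) (b : ℕ))) = ⊤ := by
  have h : (fun b : Fin (d + 1) => basisElt d (d - (b : ℕ)) (b : ℕ)) =
      (stdBasis d).reindex Fin.revPerm := by
    funext b
    rw [Module.Basis.reindex_apply, stdBasis_apply, Fin.revPerm_symm, Fin.revPerm_apply,
      Fin.val_rev]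
    congr 1 <;> omega
  rw [h]
  exact ⟨Module.Basis.linearIndependent _, Module.Basis.span_eq _⟩

end ISchur

end

theorem mainTheorem6 :
    -- The standard basis of `S^ı(2,d)` is a basis over `ℚ(v)`.
    (∀ d : ℕ,
      LinearIndependent ISchur.K
        (fun b : Fin (d + 1) => ISchur.basisElt d (d - (b : ℕ)) (b : ℕ)) ∧
      Submodule.span ISchur.K
        (Set.range (fun b : Fin (d + 1) => ISchur.basisElt d (d - (b : ℕ)) (b : ℕ))) = ⊤) ∧
    -- The bar involution exists and is unique.
    (∀ d : ℕ, ∃! bar : ISchur.S d →ₛₗ[ISchur.barK] ISchur.S d, ISchur.IsBar d bar) ∧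
    ∃ γ : ℕ → ℕ → ISchur.K,
      -- The canonical basis element `{A_{a,r}}` exists, is unique, and its coefficients in the
      -- standard basis are the `γ a i`, independently of `r`.
      (∀ a r d : ℕ, a + r = d → ∀ bar : ISchur.S d →ₛₗ[ISchur.barK] ISchur.S d,
        ISchur.IsBar d bar → ∀ x : ISchur.S d,
          (ISchur.IsCanonical d bar a r x ↔
            x = ∑ i ∈ Finset.range (r + 1), γ a i • ISchur.basisElt d (a + i) (r - i))) ∧
      (∀ a s : ℕ, Even a →
        γ a (2 * s) =
          ISchur.v ^ (-2 * (s : ℤ) ^ 2 - (s : ℤ)) *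
            ∏ k ∈ Finset.Icc 1 s,
              (1 - ISchur.v ^ (-2 * (a : ℤ) - 4 * (k : ℤ))) / (1 - ISchur.v ^ (-4 * (k : ℤ))) ∧
        γ a (2 * s + 1) =
          ISchur.v ^ (-(a : ℤ) - 2 * (s : ℤ) ^ 2 - 3 * (s : ℤ) - 1) *
            ∏ k ∈ Finset.Icc 1 s,
              (1 - ISchur.v ^ (-2 * (a : ℤ) - 4 * (k : ℤ))) / (1 - ISchur.v ^ (-4 * (k : ℤ)))) ∧
      (∀ a s : ℕ, Odd a →
        γ a (2 * s) =
          ISchur.v ^ (-2 * (s : ℤ) ^ 2 + (s : ℤ)) *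
            ∏ k ∈ Finset.Icc 1 s,
              (1 - ISchur.v ^ (-2 * (a : ℤ) - 4 * (k : ℤ) - 2)) / (1 - ISchur.v ^ (-4 * (k : ℤ))) ∧
        γ a (2 * s + 1) =
          ISchur.v ^ (-(a : ℤ) - 2 * (s : ℤ) ^ 2 - (s : ℤ) - 1) *
            ∏ k ∈ Finset.Icc 1 s,
              (1 - ISchur.v ^ (-2 * (a : ℤ) - 4 * (k : ℤ) - 2)) / (1 - ISchur.v ^ (-4 * (k : ℤ)))) := by
  refine ⟨ISchur.standard_basis, ISchur.existsUnique_isBar, ISchur.canStdCoef ISchur.v,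
    fun a r d h bar hbar x => ISchur.isCanonical_iff h hbar x,
    fun a s ha => ISchur.canStdCoef_of_even ISchur.v_zpow_ne_one
      ISchur.v_ne_zero ha s, fun a s ha => ?_⟩
  have h := ISchur.canStdCoef_of_odd ISchur.v_zpow_ne_one ISchur.v_ne_zero ha s
  -- The extra `-2` in the odd case is the trace of the shift from `a` to `b = a + 1`.
  have e (k : ℕ) : -2 * ((a + 1 : ℕ) : ℤ) - 4 * (k : ℤ) = -2 * (a : ℤ) - 4 * (k : ℤ) - 2 := by
    push_cast
    ring
  simpa only [ISchur.closedProd, e] using h
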